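/- Let $(\mathbb{B},\|\cdot\|)$ be a separable real Banach space and let $\beta\ge 0$. Assume that $\mathbb{B}$ is $\beta$-smooth, meaning that its norm $f=\|\cdot\|$ is $(2,\beta)$-smooth: for all $x,y\in\mathbb{B}$, $f(0)=0$, $|f(x+y)-f(x)|\le\|y\|$ and $f(x+y)^2+f(x-y)^2\le 2f(x)^2+2\beta^2\|y\|^2$. Let $p\in(1,2]$ and let $(X_n)_{n\ge1}$ be $\mathbb{B}$-valued random variables on a probability space, adapted to a filtration $(\mathcal{F}_n)_{n\ge0}$, such that $\mathbb{E}\|X_n\|^p<\infty$ and $\mathbb{E}(X_n\mid\mathcal{F}_{n-1})=0$ almost surely for all $n\ge1$. Put $S_n:=X_1+\cdots+X_n$ for $n\ge0$ (so $S_0=0$). Then the following hold for every $n\ge0$, and all expectations that appear are finite. 1. If the $(X_n)_{n\ge1}$ are independent, then $$\mathbb{E}\|S_n\|^p\le 2^p\beta^p\,\mathbb{E}\Big[\Big(\sum_{m=1}^n\|X_m\|^2\Big)^{p/2}\Big]\le 2^p\beta^p\sum_{m=1}^n\mathbb{E}\|X_m\|^p.$$ 2. In general, without assuming independence, $$\mathbb{E}\|S_n\|^p\le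 2^p\beta^p\sum_{m=1}^n\mathbb{E}\|X_m\|^p.$$ -/

import Mathlib

open MeasureTheory ProbabilityTheory

/-- A real-valued function `f` on a normed space is `(2, β)`-smooth if `f 0 = 0`, `f` is
`1`-Lipschitz, and `f (x + y) ^ 2 + f (x - y) ^ 2 ≤ 2 * f x ^ 2 + 2 * β ^ 2 * ‖y‖ ^ 2`. -/
structure IsTwoSmoothFun {B : Type*} [NormedAddCommGroup B] (β : ℝ) (f : B → ℝ) : Prop where
  map_zero : f 0 = 0
  abs_sub_le : ∀ x y : B, |f (x + y) - f x| ≤ ‖y‖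
  sq_add_sq_le : ∀ x y : B,
    f (x + y) ^ 2 + f (x - y) ^ 2 ≤ 2 * f x ^ 2 + 2 * β ^ 2 * ‖y‖ ^ 2

/-- A normed space is `β`-smooth if its norm is a `(2, β)`-smooth function. -/
def IsBetaSmooth (B : Type*) [NormedAddCommGroup B] (β : ℝ) : Prop :=
  IsTwoSmoothFun β (fun x : B => ‖x‖)

/-- The partial sums `S_n = X_1 + ⋯ + X_n` of a sequence `(X_n)_{n ≥ 1}`
(the value `X 0` plays no role). -/
def partialSum {Ω B : Type*} [NormedAddCommGroup B] (X : ℕ → Ω → B) (n : ℕ) (ω : Ω) : B :=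
  ∑ m ∈ Finset.Icc 1 n, X m ω

section Deterministic

variable {B : Type*} [NormedAddCommGroup B]

/-! Both parts rest on `t ↦ t ^ (p / 2)` being concave and subadditive on `[0, ∞)`. Martingale case:
smoothness gives a two-point inequality for `‖x ± y‖ ^ p`. With `x = S_n` and `y = X_{n+1}`,
conditional Jensen yields `E‖S_n‖ ^ p ≤ E‖S_n - X_{n+1}‖ ^ p`, so each increment costs at most `2 β
^ p E‖X_{n+1}‖ ^ p`, and `2 ≤ 2 ^ p`. Independent case: signs are averaged over subsets `A` of the
index set, with no auxiliary probability space. Independence and centering permit any fixed choice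
of signs at the cost of `2 ^ p`; the sign average is then bounded pointwise by iterating smoothness.
-/

theorem Real.rpow_add_rpow_le_two_mul_rpow {a b c q : ℝ} (ha : 0 ≤ a) (hb : 0 ≤ b)
    (hc : a + b ≤ 2 * c) (hq0 : 0 ≤ q) (hq1 : q ≤ 1) : a ^ q + b ^ q ≤ 2 * c ^ q := by
  have h := (Real.concaveOn_rpow hq0 hq1).2 (Set.mem_Ici.2 ha) (Set.mem_Ici.2 hb)
    (by norm_num : (0 : ℝ) ≤ 1 / 2) (by norm_num : (0 : ℝ) ≤ 1 / 2) (by norm_num)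
  simp only [smul_eq_mul] at h
  have h2 : (1 / 2 * a + 1 / 2 * b) ^ q ≤ c ^ q :=
    Real.rpow_le_rpow (by positivity) (by linarith) hq0
  linarith

theorem Real.rpow_sum_le_sum_rpow {ι : Type*} (s : Finset ι) {f : ι → ℝ} {q : ℝ}
    (hf : ∀ i ∈ s, 0 ≤ f i) (hq0 : 0 < q) (hq1 : q ≤ 1) :
    (∑ i ∈ s, f i) ^ q ≤ ∑ i ∈ s, f i ^ q := by
  classical
  induction s using Finset.induction_on with
  | empty => simp [Real.zero_rpow hq0.ne']
  | insert a s ha ih =>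
    rw [Finset.sum_insert ha, Finset.sum_insert ha]
    have hs : ∀ i ∈ s, 0 ≤ f i := fun i hi => hf i (Finset.mem_insert_of_mem hi)
    exact (Real.rpow_add_le_add_rpow (hf a (Finset.mem_insert_self a s))
      (Finset.sum_nonneg hs) hq0.le hq1).trans (by linarith [ih hs])

theorem Real.sq_rpow_half {x : ℝ} (hx : 0 ≤ x) (p : ℝ) : (x ^ 2) ^ (p / 2) = x ^ p := by
  rw [← Real.rpow_natCast, ← Real.rpow_mul hx]
  congr 1
  push_cast
  ring

/-- Smoothness raised to the power `p / 2`: concavity handles the left side, subadditivity splits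
the right. -/
theorem IsBetaSmooth.norm_add_rpow_add_norm_sub_rpow_le {β p : ℝ} (hB : IsBetaSmooth B β)
    (hβ : 0 ≤ β) (hp0 : 0 < p) (hp2 : p ≤ 2) (x y : B) :
    ‖x + y‖ ^ p + ‖x - y‖ ^ p ≤ 2 * ‖x‖ ^ p + 2 * β ^ p * ‖y‖ ^ p := by
  have h := Real.rpow_add_rpow_le_two_mul_rpow (q := p / 2) (c := ‖x‖ ^ 2 + (β * ‖y‖) ^ 2)
    (sq_nonneg ‖x + y‖) (sq_nonneg ‖x - y‖) (by linarith [hB.sq_add_sq_le x y])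
    (by linarith) (by linarith)
  have h2 := Real.rpow_add_le_add_rpow (p := p / 2) (sq_nonneg ‖x‖) (sq_nonneg (β * ‖y‖))
    (by linarith) (by linarith)
  rw [Real.sq_rpow_half (norm_nonneg _), Real.sq_rpow_half (norm_nonneg _)] at h
  rw [Real.sq_rpow_half (norm_nonneg _), Real.sq_rpow_half (by positivity),
    Real.mul_rpow hβ (norm_nonneg _)] at h2
  linarith

/-- The averaged sum over all choices of signs; `A` is the set of indices with sign `+`. -/
theorem IsBetaSmooth.sum_powerset_rpow_le {β q : ℝ} (hB : IsBetaSmooth B β)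
    (hq0 : 0 ≤ q) (hq1 : q ≤ 1) {ι : Type*} [DecidableEq ι] (s : Finset ι) (x : ι → B) (z : B)
    {c : ℝ} (hc : 0 ≤ c) :
    ∑ A ∈ s.powerset, (‖z + (∑ i ∈ A, x i - ∑ i ∈ s \ A, x i)‖ ^ 2 + c) ^ q ≤
      2 ^ s.card * (‖z‖ ^ 2 + c + β ^ 2 * ∑ i ∈ s, ‖x i‖ ^ 2) ^ q := by
  -- The sign of the new term is absorbed into the base point, `z ± x a`. Squares stay inside the
  -- power throughout, which preserves the square function instead of a sum of `p`-th powers.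
  induction s using Finset.induction_on generalizing z with
  | empty => simp
  | insert a s ha ih =>
    rw [Finset.sum_powerset_insert ha, Finset.card_insert_of_notMem ha, Finset.sum_insert ha]
    have h1 : ∀ A ∈ s.powerset,
        z + (∑ i ∈ A, x i - ∑ i ∈ insert a s \ A, x i) =
          (z - x a) + (∑ i ∈ A, x i - ∑ i ∈ s \ A, x i) := by
      intro A hA
      have haA : a ∉ A := fun h => ha (Finset.mem_powerset.1 hA h)
      rw [Finset.insert_sdiff_of_notMem _ haA,
        Finset.sum_insert (fun h => ha (Finset.mem_sdiff.1 h).1)]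
      abel
    have h2 : ∀ A ∈ s.powerset,
        z + (∑ i ∈ insert a A, x i - ∑ i ∈ insert a s \ insert a A, x i) =
          (z + x a) + (∑ i ∈ A, x i - ∑ i ∈ s \ A, x i) := by
      intro A hA
      have haA : a ∉ A := fun h => ha (Finset.mem_powerset.1 hA h)
      rw [Finset.insert_sdiff_insert, Finset.sdiff_insert_of_notMem ha, Finset.sum_insert haA]
      abel
    have hS : 0 ≤ ∑ i ∈ s, ‖x i‖ ^ 2 := Finset.sum_nonneg fun i _ => sq_nonneg _
    have h3 := Real.rpow_add_rpow_le_two_mul_rpow (q := q)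
      (a := ‖z - x a‖ ^ 2 + c + β ^ 2 * ∑ i ∈ s, ‖x i‖ ^ 2)
      (b := ‖z + x a‖ ^ 2 + c + β ^ 2 * ∑ i ∈ s, ‖x i‖ ^ 2)
      (c := ‖z‖ ^ 2 + c + β ^ 2 * (‖x a‖ ^ 2 + ∑ i ∈ s, ‖x i‖ ^ 2))
      (by positivity) (by positivity) (by linarith [hB.sq_add_sq_le z (x a)]) hq0 hq1
    calc _ = ∑ A ∈ s.powerset, (‖(z - x a) + (∑ i ∈ A, x i - ∑ i ∈ s \ A, x i)‖ ^ 2 + c) ^ q +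
          ∑ A ∈ s.powerset, (‖(z + x a) + (∑ i ∈ A, x i - ∑ i ∈ s \ A, x i)‖ ^ 2 + c) ^ q :=
        congrArg₂ _ (Finset.sum_congr rfl fun A hA => by rw [h1 A hA])
          (Finset.sum_congr rfl fun A hA => by rw [h2 A hA])
      _ ≤ _ := add_le_add (ih (z - x a)) (ih (z + x a))
      _ = 2 ^ s.card * ((‖z - x a‖ ^ 2 + c + β ^ 2 * ∑ i ∈ s, ‖x i‖ ^ 2) ^ q +
          (‖z + x a‖ ^ 2 + c + β ^ 2 * ∑ i ∈ s, ‖x i‖ ^ 2) ^ q) := by ring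
      _ ≤ _ := mul_le_mul_of_nonneg_left h3 (by positivity)
      _ = 2 ^ (s.card + 1) *
          (‖z‖ ^ 2 + c + β ^ 2 * (‖x a‖ ^ 2 + ∑ i ∈ s, ‖x i‖ ^ 2)) ^ q := by ring

theorem IsBetaSmooth.sum_powerset_norm_rpow_le {β p : ℝ} (hB : IsBetaSmooth B β)
    (hβ : 0 ≤ β) (hp0 : 0 < p) (hp2 : p ≤ 2) {ι : Type*} [DecidableEq ι] (s : Finset ι)
    (x : ι → B) :
    ∑ A ∈ s.powerset, ‖∑ i ∈ A, x i - ∑ i ∈ s \ A, x i‖ ^ p ≤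
      2 ^ s.card * (β ^ p * (∑ i ∈ s, ‖x i‖ ^ 2) ^ (p / 2)) := by
  have h := hB.sum_powerset_rpow_le (q := p / 2) (by linarith) (by linarith) s x 0 le_rfl
  simpa [Real.sq_rpow_half, Real.mul_rpow, hβ, Finset.sum_nonneg, sq_nonneg] using h

end Deterministic

section Probability

variable {B : Type*} [NormedAddCommGroup B] [NormedSpace ℝ B] [CompleteSpace B]
  {Ω : Type*} {mΩ : MeasurableSpace Ω} {P : Measure Ω} {p : ℝ}

theorem MeasureTheory.integrable_norm_rpow_iff_memLp_ofReal {E : Type*} [NormedAddCommGroup E]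
    (hp : 0 < p) {f : Ω → E} (hf : AEStronglyMeasurable f P) :
    Integrable (fun ω => ‖f ω‖ ^ p) P ↔ MemLp f (ENNReal.ofReal p) P := by
  rw [← integrable_norm_rpow_iff hf (by simpa using hp) ENNReal.ofReal_ne_top,
    ENNReal.toReal_ofReal hp.le]

theorem MeasureTheory.MemLp.integrable_norm_rpow_ofReal {E : Type*} [NormedAddCommGroup E]
    (hp : 0 < p) {f : Ω → E} (hf : MemLp f (ENNReal.ofReal p) P) :
    Integrable (fun ω => ‖f ω‖ ^ p) P :=
  (integrable_norm_rpow_iff_memLp_ofReal hp hf.1).2 hf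

/-- `U` is the conditional expectation of `U - V` given `m`, so conditional Jensen applies. -/
theorem integral_norm_rpow_le_integral_norm_sub_rpow (hp : 1 ≤ p) [IsFiniteMeasure P]
    {m : MeasurableSpace Ω} (hm : m ≤ mΩ) {U V : Ω → B} (hUm : StronglyMeasurable[m] U)
    (hU : MemLp U (ENNReal.ofReal p) P) (hV : MemLp V (ENNReal.ofReal p) P)
    (hV0 : P[V | m] =ᵐ[P] 0) :
    ∫ ω, ‖U ω‖ ^ p ∂P ≤ ∫ ω, ‖U ω - V ω‖ ^ p ∂P := by
  have hp' : 1 ≤ ENNReal.ofReal p := by simpa using hp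
  have hUi := hU.integrable hp'
  have hVi := hV.integrable hp'
  have h : P[U - V | m] =ᵐ[P] U := by
    filter_upwards [condExp_sub hUi hVi m, hV0] with ω h1 h2
    rw [h1, Pi.sub_apply, h2, condExp_of_stronglyMeasurable hm hUm hUi]
    simp
  calc ∫ ω, ‖U ω‖ ^ p ∂P = ∫ ω, ‖(P[U - V | m]) ω‖ ^ p ∂P :=
        integral_congr_ae (h.mono fun ω hω => by simp only [hω])
    _ ≤ ∫ ω, ‖(U - V) ω‖ ^ p ∂P :=
        integral_norm_condExp_rpow_le hp ((hU.sub hV).integrable_norm_rpow_ofReal (by linarith))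

theorem IsBetaSmooth.integral_norm_add_rpow_le {β : ℝ} (hB : IsBetaSmooth B β) (hβ : 0 ≤ β)
    (hp1 : 1 ≤ p) (hp2 : p ≤ 2) [IsFiniteMeasure P]
    {m : MeasurableSpace Ω} (hm : m ≤ mΩ) {U V : Ω → B} (hUm : StronglyMeasurable[m] U)
    (hU : MemLp U (ENNReal.ofReal p) P) (hV : MemLp V (ENNReal.ofReal p) P)
    (hV0 : P[V | m] =ᵐ[P] 0) :
    ∫ ω, ‖U ω + V ω‖ ^ p ∂P ≤ ∫ ω, ‖U ω‖ ^ p ∂P + 2 * β ^ p * ∫ ω, ‖V ω‖ ^ p ∂P := by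
  have hp0 : 0 < p := by linarith
  have hUi := hU.integrable_norm_rpow_ofReal hp0
  have hVi := hV.integrable_norm_rpow_ofReal hp0
  have hadd : Integrable (fun ω => ‖U ω + V ω‖ ^ p) P :=
    (hU.add hV).integrable_norm_rpow_ofReal hp0
  have hsub : Integrable (fun ω => ‖U ω - V ω‖ ^ p) P :=
    (hU.sub hV).integrable_norm_rpow_ofReal hp0
  have h := integral_mono (hadd.add hsub) ((hUi.const_mul 2).add (hVi.const_mul (2 * β ^ p)))
    fun ω => hB.norm_add_rpow_add_norm_sub_rpow_le hβ hp0 hp2 (U ω) (V ω)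
  simp only [Pi.add_apply] at h
  rw [integral_add hadd hsub, integral_add (hUi.const_mul 2) (hVi.const_mul _),
    integral_const_mul, integral_const_mul] at h
  linarith [integral_norm_rpow_le_integral_norm_sub_rpow hp1 hm hUm hU hV hV0]

theorem integrable_sum_norm_sq_rpow {ι : Type*} (s : Finset ι) {E : Type*} [NormedAddCommGroup E]
    {Y : ι → Ω → E}
    (hp0 : 0 < p) (hp2 : p ≤ 2) (hY : ∀ i ∈ s, MemLp (Y i) (ENNReal.ofReal p) P) :
    Integrable (fun ω => (∑ i ∈ s, ‖Y i ω‖ ^ 2) ^ (p / 2)) P := by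
  -- By subadditivity, `∑ ‖Y i‖ ^ p` is an integrable majorant.
  refine Integrable.mono' (integrable_finsetSum s fun i hi =>
    (hY i hi).integrable_norm_rpow_ofReal hp0) ?_ (ae_of_all _ fun ω => ?_)
  · exact ((Finset.aemeasurable_fun_sum s fun i hi =>
      ((hY i hi).1.norm.aemeasurable.pow_const 2)).pow_const _).aestronglyMeasurable
  · rw [Real.norm_of_nonneg (by positivity)]
    refine (Real.rpow_sum_le_sum_rpow s (fun i _ => sq_nonneg _) (by linarith)
      (by linarith)).trans_eq (Finset.sum_congr rfl fun i _ => ?_)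
    exact Real.sq_rpow_half (norm_nonneg _) p

theorem integral_sum_norm_sq_rpow_le {ι : Type*} (s : Finset ι) {E : Type*} [NormedAddCommGroup E]
    {Y : ι → Ω → E}
    (hp0 : 0 < p) (hp2 : p ≤ 2) (hY : ∀ i ∈ s, MemLp (Y i) (ENNReal.ofReal p) P) :
    ∫ ω, (∑ i ∈ s, ‖Y i ω‖ ^ 2) ^ (p / 2) ∂P ≤ ∑ i ∈ s, ∫ ω, ‖Y i ω‖ ^ p ∂P := by
  have hi := fun i hi => (hY i hi).integrable_norm_rpow_ofReal hp0
  rw [← integral_finsetSum s hi]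
  refine integral_mono (integrable_sum_norm_sq_rpow s hp0 hp2 hY)
    (integrable_finsetSum s hi) fun ω => ?_
  refine (Real.rpow_sum_le_sum_rpow s (fun i _ => sq_nonneg _) (by linarith)
    (by linarith)).trans_eq (Finset.sum_congr rfl fun i _ => ?_)
  exact Real.sq_rpow_half (norm_nonneg _) p

variable [MeasurableSpace B] [BorelSpace B] [SecondCountableTopology B]

/-- Conditioning is on the σ-algebra generated by `U`, where independence makes the conditional mean
of `V` constant. -/
theorem ProbabilityTheory.IndepFun.integral_norm_rpow_le_integral_norm_sub_rpow (hp : 1 ≤ p)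
    [IsProbabilityMeasure P] {U V : Ω → B} (hUV : IndepFun U V P)
    (hUm : Measurable U) (hVm : Measurable V)
    (hU : MemLp U (ENNReal.ofReal p) P) (hV : MemLp V (ENNReal.ofReal p) P)
    (hV0 : ∫ ω, V ω ∂P = 0) :
    ∫ ω, ‖U ω‖ ^ p ∂P ≤ ∫ ω, ‖U ω - V ω‖ ^ p ∂P := by
  refine _root_.integral_norm_rpow_le_integral_norm_sub_rpow hp hUm.comap_le
    (comap_measurable U).stronglyMeasurable hU hV ?_
  have h := condExp_indep_eq hVm.comap_le hUm.comap_le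
    (comap_measurable V).stronglyMeasurable ((IndepFun_iff_Indep V U P).1 hUV.symm)
  simpa [hV0] using! h

/-- Source of the constant `2 ^ p`: convexity contributes `2 ^ (p - 1)`, and bounding both `E‖U‖ ^
p` and `E‖V‖ ^ p` by `E‖U - V‖ ^ p` contributes the remaining `2`. -/
theorem ProbabilityTheory.IndepFun.integral_norm_add_rpow_le_integral_norm_sub_rpow (hp : 1 ≤ p)
    [IsProbabilityMeasure P] {U V : Ω → B} (hUV : IndepFun U V P)
    (hUm : Measurable U) (hVm : Measurable V)
    (hU : MemLp U (ENNReal.ofReal p) P) (hV : MemLp V (ENNReal.ofReal p) P)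
    (hU0 : ∫ ω, U ω ∂P = 0) (hV0 : ∫ ω, V ω ∂P = 0) :
    ∫ ω, ‖U ω + V ω‖ ^ p ∂P ≤ 2 ^ p * ∫ ω, ‖U ω - V ω‖ ^ p ∂P := by
  have hp0 : 0 < p := by linarith
  have hUi := hU.integrable_norm_rpow_ofReal hp0
  have hVi := hV.integrable_norm_rpow_ofReal hp0
  have h1 := hUV.integral_norm_rpow_le_integral_norm_sub_rpow hp hUm hVm hU hV hV0
  have h2 := hUV.symm.integral_norm_rpow_le_integral_norm_sub_rpow hp hVm hUm hV hU hU0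
  simp only [norm_sub_rev (V _)] at h2
  have h3 : ∫ ω, ‖U ω + V ω‖ ^ p ∂P ≤
      ∫ ω, 2 ^ (p - 1) * (‖U ω‖ ^ p + ‖V ω‖ ^ p) ∂P := by
    refine integral_mono ((hU.add hV).integrable_norm_rpow_ofReal hp0)
      ((hUi.add hVi).const_mul _) fun ω => ?_
    exact (Real.rpow_le_rpow (norm_nonneg _) (norm_add_le _ _) hp0.le).trans
      (mod_cast NNReal.rpow_add_le_mul_rpow_add_rpow ‖U ω‖₊ ‖V ω‖₊ hp)
  rw [integral_const_mul, integral_add hUi hVi] at h3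
  have h4 : (2 : ℝ) ^ p = 2 ^ (p - 1) * 2 := by
    rw [Real.rpow_sub_one two_ne_zero]; ring
  calc _ ≤ _ := h3
    _ ≤ 2 ^ (p - 1) * (∫ ω, ‖U ω - V ω‖ ^ p ∂P + ∫ ω, ‖U ω - V ω‖ ^ p ∂P) := by gcongr
    _ = _ := by rw [h4]; ring

theorem IsBetaSmooth.integral_norm_sum_rpow_le_of_iIndepFun {β : ℝ} (hB : IsBetaSmooth B β)
    (hβ : 0 ≤ β) (hp1 : 1 ≤ p) (hp2 : p ≤ 2) [IsProbabilityMeasure P] {ι : Type*}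
    (s : Finset ι) {Y : ι → Ω → B} (hind : iIndepFun Y P) (hm : ∀ i, Measurable (Y i))
    (hY : ∀ i, MemLp (Y i) (ENNReal.ofReal p) P) (hY0 : ∀ i, ∫ ω, Y i ω ∂P = 0) :
    ∫ ω, ‖∑ i ∈ s, Y i ω‖ ^ p ∂P ≤
      2 ^ p * β ^ p * ∫ ω, (∑ i ∈ s, ‖Y i ω‖ ^ 2) ^ (p / 2) ∂P := by
  classical
  have hp0 : 0 < p := by linarith
  have hL : ∀ A : Finset ι, MemLp (fun ω => ∑ i ∈ A, Y i ω) (ENNReal.ofReal p) P :=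
    fun A => memLp_finsetSum A fun i _ => hY i
  have hM : ∀ A : Finset ι, Measurable fun ω => ∑ i ∈ A, Y i ω :=
    fun A => Finset.measurable_fun_sum A fun i _ => hm i
  have hZ : ∀ A : Finset ι, ∫ ω, ∑ i ∈ A, Y i ω ∂P = 0 := fun A => by
    rw [integral_finsetSum A fun i _ => (hY i).integrable (by simpa using hp1)]
    exact Finset.sum_eq_zero fun i _ => hY0 i
  have hI : ∀ A ∈ s.powerset,
      Integrable (fun ω => ‖∑ i ∈ A, Y i ω - ∑ i ∈ s \ A, Y i ω‖ ^ p) P := fun A _ =>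
    ((hL A).sub (hL (s \ A))).integrable_norm_rpow_ofReal hp0
  -- Flipping the signs outside `A` compares the full sum `U + V` with `U - V`, where `U` and `V`
  -- are the independent partial sums over `A` and `s \ A`.
  have key : ∀ A ∈ s.powerset, ∫ ω, ‖∑ i ∈ s, Y i ω‖ ^ p ∂P ≤
      2 ^ p * ∫ ω, ‖∑ i ∈ A, Y i ω - ∑ i ∈ s \ A, Y i ω‖ ^ p ∂P := fun A hA => by
    have hAI : IndepFun (fun ω => ∑ i ∈ A, Y i ω) (fun ω => ∑ i ∈ s \ A, Y i ω) P := by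
      have h := (hind.indepFun_finset A (s \ A) Finset.disjoint_sdiff hm).comp
        (φ := fun x : A → B => ∑ i, x i) (ψ := fun x : ↥(s \ A) → B => ∑ i, x i)
        (by fun_prop) (by fun_prop)
      convert! h using 1
      · ext ω; exact (Finset.sum_coe_sort A fun i => Y i ω).symm
      · ext ω; exact (Finset.sum_coe_sort (s \ A) fun i => Y i ω).symm
    refine le_of_eq_of_le ?_ (hAI.integral_norm_add_rpow_le_integral_norm_sub_rpow hp1
      (hM _) (hM _) (hL _) (hL _) (hZ _) (hZ _))
    congr! 4 with ω
    rw [add_comm, Finset.sum_sdiff (Finset.mem_powerset.1 hA)]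
  have h1 := Finset.sum_le_sum key
  rw [Finset.sum_const, Finset.card_powerset, nsmul_eq_mul, ← Finset.mul_sum,
    ← integral_finsetSum _ hI] at h1
  have h2 := integral_mono (integrable_finsetSum _ hI)
    (((integrable_sum_norm_sq_rpow s hp0 hp2 fun i _ => hY i).const_mul (β ^ p)).const_mul
      (2 ^ s.card)) fun ω => hB.sum_powerset_norm_rpow_le hβ hp0 hp2 s fun i => Y i ω
  rw [integral_const_mul, integral_const_mul] at h2
  have h3 := h1.trans (mul_le_mul_of_nonneg_left h2 (by positivity : (0 : ℝ) ≤ 2 ^ p))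
  push_cast at h3
  -- Summing over all `A` put the number of sign choices, `2 ^ s.card`, on both sides.
  refine le_of_mul_le_mul_left (h3.trans_eq ?_) (by positivity : (0 : ℝ) < 2 ^ s.card)
  ring

end Probability

theorem Finset.sum_Icc_one_eq_sum_range {M : Type*} [AddCommMonoid M] (f : ℕ → M) (n : ℕ) :
    ∑ m ∈ Finset.Icc 1 n, f m = ∑ i ∈ Finset.range n, f (i + 1) := by
  induction n with
  | zero => simp
  | succ n ih => rw [Finset.sum_Icc_succ_top (by omega), ih, Finset.sum_range_succ]


theorem mainTheorem6
    {B : Type*} [NormedAddCommGroup B] [NormedSpace ℝ B] [CompleteSpace B]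
    [TopologicalSpace.SeparableSpace B] [MeasurableSpace B] [BorelSpace B]
    (β : ℝ) (hβ : 0 ≤ β) (hB : IsBetaSmooth B β)
    {Ω : Type*} {mΩ : MeasurableSpace Ω} (P : Measure Ω) [IsProbabilityMeasure P]
    (ℱ : Filtration ℕ mΩ) (X : ℕ → Ω → B) (p : ℝ) (hp1 : 1 < p) (hp2 : p ≤ 2)
    (hadapted : ∀ n : ℕ, 1 ≤ n → Measurable[ℱ n] (X n))
    (hmoment : ∀ n : ℕ, 1 ≤ n → Integrable (fun ω => ‖X n ω‖ ^ p) P)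
    (hmean : ∀ n : ℕ, 1 ≤ n → P[X n | ℱ (n - 1)] =ᵐ[P] 0) :
    (iIndepFun (fun n : ℕ => X (n + 1)) P → ∀ n : ℕ,
      Integrable (fun ω => ‖partialSum X n ω‖ ^ p) P ∧
      Integrable (fun ω => (∑ m ∈ Finset.Icc 1 n, ‖X m ω‖ ^ 2) ^ (p / 2)) P ∧
      (∫ ω, ‖partialSum X n ω‖ ^ p ∂P) ≤
        2 ^ p * β ^ p * ∫ ω, (∑ m ∈ Finset.Icc 1 n, ‖X m ω‖ ^ 2) ^ (p / 2) ∂P ∧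
      2 ^ p * β ^ p * (∫ ω, (∑ m ∈ Finset.Icc 1 n, ‖X m ω‖ ^ 2) ^ (p / 2) ∂P) ≤
        2 ^ p * β ^ p * ∑ m ∈ Finset.Icc 1 n, ∫ ω, ‖X m ω‖ ^ p ∂P) ∧
    (∀ n : ℕ,
      Integrable (fun ω => ‖partialSum X n ω‖ ^ p) P ∧
      (∫ ω, ‖partialSum X n ω‖ ^ p ∂P) ≤
        2 ^ p * β ^ p * ∑ m ∈ Finset.Icc 1 n, ∫ ω, ‖X m ω‖ ^ p ∂P) := by
  have hp0 : 0 < p := by linarith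
  have : SecondCountableTopology B := UniformSpace.secondCountable_of_separable B
  have hmeas : ∀ n, 1 ≤ n → Measurable (X n) := fun n hn => (hadapted n hn).mono (ℱ.le n) le_rfl
  have hL : ∀ n, 1 ≤ n → MemLp (X n) (ENNReal.ofReal p) P := fun n hn =>
    (integrable_norm_rpow_iff_memLp_ofReal hp0 (hmeas n hn).aestronglyMeasurable).1 (hmoment n hn)
  have hS : ∀ n, MemLp (partialSum X n) (ENNReal.ofReal p) P := fun n =>
    memLp_finsetSum _ fun m hm => hL m (Finset.mem_Icc.1 hm).1
  have hSi := fun n => (hS n).integrable_norm_rpow_ofReal hp0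
  refine ⟨fun hind n => ?_, fun n => ⟨hSi n, ?_⟩⟩
  · have hL' : ∀ m ∈ Finset.Icc 1 n, MemLp (X m) (ENNReal.ofReal p) P := fun m hm =>
      hL m (Finset.mem_Icc.1 hm).1
    refine ⟨hSi n, integrable_sum_norm_sq_rpow _ hp0 hp2 hL', ?_,
      mul_le_mul_of_nonneg_left (integral_sum_norm_sq_rpow_le _ hp0 hp2 hL') (by positivity)⟩
    simp only [partialSum, Finset.sum_Icc_one_eq_sum_range]
    refine hB.integral_norm_sum_rpow_le_of_iIndepFun hβ hp1.le hp2 (Finset.range n) hind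
      (fun i => hmeas _ (by omega)) (fun i => hL _ (by omega)) fun i => ?_
    -- A vanishing conditional mean forces a vanishing mean.
    rw [← integral_condExp (ℱ.le i), integral_congr_ae (by simpa using! hmean (i + 1) (by omega))]
    exact integral_zero Ω B
  · induction n with
    | zero => simp [partialSum, Real.zero_rpow hp0.ne']
    | succ n ih =>
      have hSm : Measurable[ℱ n] (partialSum X n) :=
        Finset.measurable_fun_sum _ fun m hm =>
          (hadapted m (Finset.mem_Icc.1 hm).1).mono (ℱ.mono (Finset.mem_Icc.1 hm).2) le_rfl
      have h := hB.integral_norm_add_rpow_le hβ hp1.le hp2 (ℱ.le n) hSm.stronglyMeasurable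
        (hS n) (hL (n + 1) (by omega)) (hmean (n + 1) (by omega))
      have h2 : (2 : ℝ) ≤ 2 ^ p := by
        simpa using Real.rpow_le_rpow_of_exponent_le one_le_two hp1.le
      have h3 : 2 * β ^ p * ∫ ω, ‖X (n + 1) ω‖ ^ p ∂P ≤
          2 ^ p * β ^ p * ∫ ω, ‖X (n + 1) ω‖ ^ p ∂P := by gcongr
      rw [Finset.sum_Icc_succ_top (by omega), mul_add]
      simp only [partialSum, Finset.sum_Icc_succ_top (Nat.le_add_left 1 n)] at h ih ⊢
      linarith
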